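/- Let $k$ be a field with multiplicative group $k^*$, and let $r,s$ be positive integers. Write $C_n$ for the cyclic group of order $n$, $\mu_n(k)=\{\alpha\in k^*:\alpha^n=1\}$, $k^{*(n)}=\{\alpha^n:\alpha\in k^*\}$, and $(r,s)$ for the greatest common divisor of $r$ and $s$. For a group $G$, let $H^3(G,k^*)$ be the third cohomology group of $G$ with coefficients in $k^*$, regarded as a trivial $G$-module. Then there are isomorphisms of abelian groups $$H^3(C_r,k^*)\cong\mu_r(k)$$ and $$H^3(C_r\times C_s,k^*)\cong k^*/k^{*(r,s)}\times\mu_r(k)\times\mu_s(k)\times\mu_{(r,s)}(k),$$ where $k^{*(r,s)}$ denotes $k^{*(n)}$ with $n=(r,s)$. -/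

import Mathlib

universe u

/-- `H³(G, k^*)`: the third cohomology group of the group `G` with coefficients in the
multiplicative group of the field `k`, on which `G` acts trivially. It is written additively, as
`Additive kˣ` is the additive group underlying the coefficients, and it is the third cohomology of
Mathlib's complex of inhomogeneous cochains `Gⁿ → k^*`. Mathlib's `groupCohomology` wants the base
ring in the universe of `G`, so the ring `ℤ` is lifted to `ULift ℤ`; the cochains, the
differentials and the additive group obtained do not depend on this lift. -/
noncomputable abbrev unitsH3 (G k : Type u) [Group G] [Field k] : ModuleCat.{u} (ULift.{u} ℤ) :=
  groupCohomology (Rep.trivial (ULift.{u} ℤ) G (Additive kˣ)) 3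

/-- The subgroup `k^{*(n)}` of `n`-th powers in the multiplicative group of the field `k`. -/
abbrev unitsPow (k : Type u) [Field k] (n : ℕ) : Subgroup kˣ :=
  (powMonoidHom n : kˣ →* kˣ).range

open CategoryTheory Representation

/-! For a finite cyclic group with generator g of order n, cohomology is computed by the periodic
complex alternating between g - 1 and the norm. On trivial coefficients these act as 0 and as the
n-th power map, so `H³` is the kernel of the n-th power map, that is `μ_n`.

For a product, the total complex of the two periodic complexes on the group ring is a free
resolution (`d_homotopy_add`, `exact_augmentation`). With trivial coefficients its degree three
cochains live at (3,0), (2,1), (1,2), (0,3). The two extreme positions contribute `μ_r` and `μ_s`.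
Writing b, c for the values at (2,1), (1,2), additively, what remains is the group of (b, c) with s
b + r c = 0, modulo the pairs (r t, -s t).

Put d = (r,s), r = d r', s = d s', and r' u + s' v = 1. The unimodular substitution X = s' b + r' c,
Y = u b - v c turns the cycle condition into d X = 0, with Y free, and the boundaries into X = 0, Y
= d t. The quotient is `μ_d × k^*/k^{*(d)}` (`nonempty_cochain_homology_addEquiv`). -/

/-- The pairs of natural numbers with sum `n`: the positions of total degree `n` in a
first-quadrant double complex. -/
abbrev Bidegree (n : ℕ) : Type u := ULift.{u} {p : ℕ × ℕ // p.1 + p.2 = n}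

/-- The position `(i, j)`, of total degree `n`. -/
abbrev Bidegree.mk {n : ℕ} (i j : ℕ) (h : i + j = n) : Bidegree.{u} n := ⟨⟨(i, j), h⟩⟩

/-! ### Periodic complexes, their total complex and its contraction. -/

section

variable {R M : Type u} [CommRing R] [AddCommGroup M] [Module R M]

/-- The differential from degree `i + 1` to degree `i` in the periodic complex of an
endomorphism `γ`: it alternates between `γ - 1` and the norm `1 + γ + ⋯ + γ ^ (n - 1)`. -/
def periodicD (γ : Module.End R M) (n i : ℕ) : Module.End R M :=
  if Even i then γ - 1 else ∑ j ∈ Finset.range n, γ ^ j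

lemma periodicD_comp {γ : Module.End R M} {n : ℕ} (h : γ ^ n = 1) (i : ℕ) :
    periodicD γ n i * periodicD γ n (i + 1) = 0 := by
  by_cases hi : Even i
  · simp [periodicD, hi, Nat.even_add_one, mul_geom_sum, h]
  · simp [periodicD, hi, Nat.even_add_one, geom_sum_mul, h]

lemma Commute.periodicD_right {γ T : Module.End R M} (h : Commute T γ) (n i : ℕ) :
    Commute T (periodicD γ n i) := by
  unfold periodicD
  split_ifs
  · exact h.sub_right (Commute.one_right T)
  · exact Commute.sum_right _ _ _ fun j _ => h.pow_right j

/-- A contracting homotopy of the periodic complex of `γ` onto the image of the projection `p` in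
degree zero. -/
structure PeriodicContraction (γ : Module.End R M) (n : ℕ) where
  /-- The projection in degree zero. -/
  p : Module.End R M
  /-- The homotopy from degree `i` to degree `i + 1`. -/
  s : ℕ → Module.End R M
  pow_eq_one : γ ^ n = 1
  d_s_zero : periodicD γ n 0 * s 0 = 1 - p
  s_d_add_d_s (i : ℕ) : s i * periodicD γ n i + periodicD γ n (i + 1) * s (i + 1) = 1
  p_d : p * periodicD γ n 0 = 0

namespace BiperiodicComplex

variable (γ δ : Module.End R M) (r s : ℕ)

/-- The horizontal part of the differential of the total complex of two commuting periodic
complexes. -/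
noncomputable def dFst {n : ℕ} : Bidegree.{u} (n + 1) → (M →ₗ[R] Bidegree.{u} n →₀ M)
  | ⟨⟨(0, _), _⟩⟩ => 0
  | ⟨⟨(i + 1, j), h⟩⟩ =>
    Finsupp.lsingle (Bidegree.mk i j (by dsimp at h; omega)) ∘ₗ periodicD γ r i

/-- The vertical part of the differential of the total complex of two commuting periodic
complexes. -/
noncomputable def dSnd {n : ℕ} : Bidegree.{u} (n + 1) → (M →ₗ[R] Bidegree.{u} n →₀ M)
  | ⟨⟨(_, 0), _⟩⟩ => 0
  | ⟨⟨(i, j + 1), h⟩⟩ =>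
    (-1 : R) ^ i • (Finsupp.lsingle (Bidegree.mk i j (by dsimp at h; omega)) ∘ₗ periodicD δ s j)

/-- The differential of the total complex of two commuting periodic complexes. -/
noncomputable def d (n : ℕ) : (Bidegree.{u} (n + 1) →₀ M) →ₗ[R] Bidegree.{u} n →₀ M :=
  Finsupp.lsum R fun p => dFst γ r p + dSnd δ s p

variable {γ δ r s}

lemma d_single {n : ℕ} (p : Bidegree.{u} (n + 1)) (m : M) :
    d γ δ r s n (Finsupp.single p m) = dFst γ r p m + dSnd δ s p m := by
  simp [d]

lemma d_comp_d (h : Commute γ δ) (hγ : γ ^ r = 1) (hδ : δ ^ s = 1) (n : ℕ) :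
    d γ δ r s n ∘ₗ d γ δ r s (n + 1) = 0 := by
  have hγ' (i : ℕ) (m : M) : periodicD γ r i (periodicD γ r (i + 1) m) = 0 :=
    congr($(periodicD_comp hγ i) m)
  have hδ' (i : ℕ) (m : M) : periodicD δ s i (periodicD δ s (i + 1) m) = 0 :=
    congr($(periodicD_comp hδ i) m)
  have hc (i j : ℕ) (m : M) : periodicD γ r i (periodicD δ s j m) =
      periodicD δ s j (periodicD γ r i m) :=
    congr($(((h.periodicD_right s j).symm.periodicD_right r i).symm.eq) m)
  ext ⟨⟨⟨i, j⟩, hij⟩⟩ m : 2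
  dsimp at hij
  rcases i with _ | _ | i <;> rcases j with _ | _ | j <;>
    simp [d_single, dFst, dSnd, hγ', hδ', hc, pow_succ]

variable (hγ : PeriodicContraction γ r) (hδ : PeriodicContraction δ s)

/-- A contracting homotopy of the total complex of two commuting periodic complexes: it is given by
the first homotopy, and on the first column also by the second one after the first projection. -/
noncomputable def homotopyOn {n : ℕ} : Bidegree.{u} n → (M →ₗ[R] Bidegree.{u} (n + 1) →₀ M)
  | ⟨⟨(0, j), h⟩⟩ =>
    Finsupp.lsingle (Bidegree.mk 1 j (by dsimp at h; omega)) ∘ₗ hγ.s 0 +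
      Finsupp.lsingle (Bidegree.mk 0 (j + 1) (by dsimp at h; omega)) ∘ₗ hδ.s j ∘ₗ hγ.p
  | ⟨⟨(i + 1, j), h⟩⟩ =>
    Finsupp.lsingle (Bidegree.mk (i + 2) j (by dsimp at h; omega)) ∘ₗ hγ.s (i + 1)

/-- The contracting homotopy of the total complex of two commuting periodic complexes. -/
noncomputable def homotopy (n : ℕ) : (Bidegree.{u} n →₀ M) →ₗ[R] Bidegree.{u} (n + 1) →₀ M :=
  Finsupp.lsum R (homotopyOn hγ hδ)

lemma homotopy_single {n : ℕ} (p : Bidegree.{u} n) (m : M) :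
    homotopy hγ hδ n (Finsupp.single p m) = homotopyOn hγ hδ p m := by
  simp [homotopy]

variable {hγ}

/-- The sign `(-1) ^ i` makes the vertical differential anticommute with the first homotopy, so the
cross terms cancel. In column zero the first homotopy leaves the defect `hγ.p`, which the second
homotopy repairs. As `hγ.p` kills γ - 1, the second homotopy need not commute with γ. -/
lemma d_homotopy_add (hs : ∀ i, Commute (hγ.s i) δ) (hp : Commute hγ.p δ) (n : ℕ) :
    d γ δ r s (n + 1) ∘ₗ homotopy hγ hδ (n + 1) + homotopy hγ hδ n ∘ₗ d γ δ r s n = .id := by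
  have hs' (i j : ℕ) (m : M) : hγ.s i (periodicD δ s j m) = periodicD δ s j (hγ.s i m) :=
    congr($((hs i).periodicD_right s j) m)
  have hp' (j : ℕ) (m : M) : hγ.p (periodicD δ s j m) = periodicD δ s j (hγ.p m) :=
    congr($(hp.periodicD_right s j) m)
  have h₁ (m : M) : periodicD γ r 0 (hγ.s 0 m) = m - hγ.p m := congr($(hγ.d_s_zero) m)
  have h₂ (i : ℕ) (m : M) : periodicD γ r (i + 1) (hγ.s (i + 1) m) =
      m - hγ.s i (periodicD γ r i m) := eq_sub_of_add_eq' congr($(hγ.s_d_add_d_s i) m)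
  have h₃ (i : ℕ) (m : M) : periodicD δ s (i + 1) (hδ.s (i + 1) m) =
      m - hδ.s i (periodicD δ s i m) := eq_sub_of_add_eq' congr($(hδ.s_d_add_d_s i) m)
  have h₄ (m : M) : hγ.p (periodicD γ r 0 m) = 0 := congr($(hγ.p_d) m)
  ext ⟨⟨⟨i, j⟩, hij⟩⟩ m : 2
  dsimp at hij
  rcases i with _ | _ | i <;> rcases j with _ | j <;>
    simp [d_single, homotopy_single, homotopyOn, dFst, dSnd, h₁, h₂, h₃, h₄, hs', hp',
      pow_succ] <;> first | omega | abel

lemma exists_d_eq (hδ : PeriodicContraction δ s) (hs : ∀ i, Commute (hγ.s i) δ)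
    (hp : Commute hγ.p δ) {n : ℕ}
    {x : Bidegree.{u} (n + 1) →₀ M} (hx : d γ δ r s n x = 0) :
    ∃ y, d γ δ r s (n + 1) y = x :=
  ⟨homotopy hγ hδ (n + 1) x, by simpa [hx] using congr($(d_homotopy_add hδ hs hp n) x)⟩

lemma d_homotopy_zero (x : Bidegree.{u} 0 →₀ M) :
    d γ δ r s 0 (homotopy hγ hδ 0 x) =
      x - Finsupp.mapRange.linearMap (hδ.p * hγ.p) x := by
  have h₁ (m : M) : periodicD γ r 0 (hγ.s 0 m) = m - hγ.p m := congr($(hγ.d_s_zero) m)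
  have h₂ (m : M) : periodicD δ s 0 (hδ.s 0 m) = m - hδ.p m := congr($(hδ.d_s_zero) m)
  suffices h : d γ δ r s 0 ∘ₗ homotopy hγ hδ 0 =
      .id - Finsupp.mapRange.linearMap (hδ.p * hγ.p) from congr($h x)
  ext ⟨⟨⟨i, j⟩, hij⟩⟩ m : 2
  dsimp at hij
  obtain ⟨rfl, rfl⟩ : i = 0 ∧ j = 0 := by omega
  simp [d_single, homotopy_single, homotopyOn, dFst, dSnd, h₁, h₂]

end BiperiodicComplex

end

/-! ### Contraction of the periodic complex on a group ring. -/

section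

variable (R : Type u) {K : Type u} [CommRing R]

lemma MonoidAlgebra.end_ext {f f' : Module.End R (MonoidAlgebra R K)}
    (h : ∀ x, f (.single x 1) = f' (.single x 1)) : f = f' :=
  MonoidAlgebra.lhom_ext' fun x => LinearMap.ext_ring (h x)

/-- The linear endomorphism of `R[K]` with prescribed values on `K`. -/
noncomputable def MonoidAlgebra.basisLift (f : K → MonoidAlgebra R K) :
    Module.End R (MonoidAlgebra R K) :=
  Finsupp.linearCombination R f ∘ₗ (MonoidAlgebra.coeffLinearEquiv R).toLinearMap

variable {R} in
lemma MonoidAlgebra.basisLift_single (f : K → MonoidAlgebra R K) (x : K) :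
    MonoidAlgebra.basisLift R f (.single x 1) = f x := by
  simp [MonoidAlgebra.basisLift]

end

/-- A decomposition of a group `K` as the set of products of one of the distinct powers
`1, g, …, g ^ (n - 1)` with an element of a transversal of the subgroup generated by `g`. -/
structure CyclicDecomposition {K : Type u} [Group K] (g : K) (n : ℕ) where
  /-- The exponent of the power of `g`. -/
  log : K → ℕ
  /-- The element of the transversal. -/
  rem : K → K
  pow_eq_one : g ^ n = 1
  log_lt (x : K) : log x < n
  pow_log_mul_rem (x : K) : g ^ log x * rem x = x
  log_pow_mul_rem (x : K) {j : ℕ} (hj : j < n) : log (g ^ j * rem x) = j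
  rem_pow_mul_rem (x : K) {j : ℕ} (hj : j < n) : rem (g ^ j * rem x) = rem x

namespace CyclicDecomposition

variable {K : Type u} [Group K] {g : K} {n : ℕ} (c : CyclicDecomposition g n)

lemma mul_eq (x : K) : g * x = g ^ (c.log x + 1) * c.rem x := by
  conv_lhs => rw [← c.pow_log_mul_rem x]
  rw [pow_succ', mul_assoc]

lemma log_mul (x : K) (h : c.log x + 1 < n) : c.log (g * x) = c.log x + 1 := by
  rw [c.mul_eq, c.log_pow_mul_rem _ h]

lemma mul_eq_rem (x : K) (h : c.log x + 1 = n) : g * x = g ^ 0 * c.rem x := by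
  rw [c.mul_eq, h, c.pow_eq_one, pow_zero]

lemma log_mul_of_eq (x : K) (h : c.log x + 1 = n) : c.log (g * x) = 0 := by
  rw [c.mul_eq_rem x h, c.log_pow_mul_rem _ (by omega)]

lemma rem_mul (x : K) : c.rem (g * x) = c.rem x := by
  have := c.log_lt x
  rcases Nat.lt_or_ge (c.log x + 1) n with h | h
  · rw [c.mul_eq, c.rem_pow_mul_rem _ h]
  · rw [c.mul_eq_rem x (by omega), c.rem_pow_mul_rem _ (by omega)]

section GroupRing

variable (R : Type u) [CommRing R]

/-- The projection of `R[K]` onto the span of the transversal. -/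
noncomputable def proj : Module.End R (MonoidAlgebra R K) :=
  MonoidAlgebra.basisLift R fun x => .single (c.rem x) 1

/-- The contracting homotopy of the periodic complex of `g` on `R[K]`. -/
noncomputable def homotopy (i : ℕ) : Module.End R (MonoidAlgebra R K) :=
  MonoidAlgebra.basisLift R fun x =>
    if Even i then ∑ j ∈ Finset.range (c.log x), .single (g ^ j * c.rem x) 1
    else if c.log x + 1 = n then .single (c.rem x) 1 else 0

variable {R}

lemma leftRegular_pow_single (j : ℕ) (x : K) (a : R) :
    (leftRegular R K g ^ j) (.single x a) = .single (g ^ j * x) a := by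
  rw [← map_pow, ofMulAction_single, smul_eq_mul]

lemma d_homotopy_zero :
    periodicD (leftRegular R K g) n 0 * c.homotopy R 0 = 1 - c.proj R := by
  refine MonoidAlgebra.end_ext R fun x => ?_
  have : ∀ j, g * (g ^ j * c.rem x) = g ^ (j + 1) * c.rem x := fun j => by
    rw [pow_succ', mul_assoc]
  simp [periodicD, homotopy, proj, MonoidAlgebra.basisLift_single, this]
  rw [← Finset.sum_sub_distrib,
    Finset.sum_range_sub fun j => MonoidAlgebra.single (g ^ j * c.rem x) (1 : R)]
  simp [c.pow_log_mul_rem]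

lemma homotopy_d_add (i : ℕ) :
    c.homotopy R i * periodicD (leftRegular R K g) n i +
      periodicD (leftRegular R K g) n (i + 1) * c.homotopy R (i + 1) = 1 := by
  -- The norm absorbs powers of g, so it takes the same value on x as on its representative in the
  -- transversal.
  have key (x : K) : ∑ j ∈ Finset.range n, MonoidAlgebra.single (g ^ j * x) (1 : R) =
      ∑ j ∈ Finset.range n, MonoidAlgebra.single (g ^ j * c.rem x) 1 := by
    have h : (∑ j ∈ Finset.range n, leftRegular R K g ^ j) * leftRegular R K g ^ c.log x =
        ∑ j ∈ Finset.range n, leftRegular R K g ^ j := by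
      induction c.log x with
      | zero => simp
      | succ l ih =>
        have := geom_sum_mul (leftRegular R K g) n
        rw [← map_pow, c.pow_eq_one, map_one, sub_self, mul_sub, mul_one, sub_eq_zero] at this
        rw [pow_succ', ← mul_assoc, this, ih]
    have := congr($h (.single (c.rem x) 1))
    simpa [LinearMap.sum_apply, leftRegular_pow_single, c.pow_log_mul_rem] using this
  refine MonoidAlgebra.end_ext R fun x => ?_
  have hx := c.log_lt x
  by_cases hi : Even i
  -- Below the top exponent the partial sums for g x and x differ by x. At the top exponent g x has
  -- an empty sum, and the norm of `c.rem x` supplies the full one.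
  · rcases Nat.lt_or_ge (c.log x + 1) n with h | h
    · simp [periodicD, homotopy, MonoidAlgebra.basisLift_single, hi, Nat.even_add_one,
        c.log_mul x h, c.rem_mul, h.ne, Finset.sum_range_succ, c.pow_log_mul_rem]
    · replace h : c.log x + 1 = n := by omega
      have hn := Finset.sum_range_succ
        (fun j => MonoidAlgebra.single (g ^ j * c.rem x) (1 : R)) (c.log x)
      rw [h, c.pow_log_mul_rem] at hn
      simp [periodicD, homotopy, MonoidAlgebra.basisLift_single, hi, Nat.even_add_one,
        c.log_mul_of_eq x h, h, LinearMap.sum_apply, leftRegular_pow_single, hn]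
  · have h₁ : ∑ j ∈ Finset.range n, c.homotopy R i (.single (g ^ j * c.rem x) 1) =
        .single (c.rem x) 1 := by
      -- The odd homotopy is nonzero only at the top exponent n - 1.
      rw [Finset.sum_eq_single_of_mem (n - 1) (by simp; omega)]
      · rw [homotopy, MonoidAlgebra.basisLift_single, if_neg hi, c.log_pow_mul_rem _ (by omega),
          if_pos (by omega), c.rem_pow_mul_rem _ (by omega)]
      · intro j hj hj'
        rw [Finset.mem_range] at hj
        rw [homotopy, MonoidAlgebra.basisLift_single, if_neg hi, c.log_pow_mul_rem _ hj,
          if_neg (by omega)]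
    have h₂ := congr($(c.d_homotopy_zero (R := R)) (.single x 1))
    have h₃ : c.homotopy R (i + 1) = c.homotopy R 0 := by
      simp [homotopy, hi, Nat.even_add_one]
    have h₄ : periodicD (leftRegular R K g) n (i + 1) = periodicD (leftRegular R K g) n 0 := by
      simp [periodicD, hi, Nat.even_add_one]
    rw [← h₃, ← h₄] at h₂
    rw [LinearMap.add_apply, h₂]
    simp [periodicD, hi, LinearMap.sum_apply, leftRegular_pow_single, key x, h₁, proj,
      MonoidAlgebra.basisLift_single]

lemma proj_d : c.proj R * periodicD (leftRegular R K g) n 0 = 0 := by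
  refine MonoidAlgebra.end_ext R fun x => ?_
  simp [periodicD, proj, MonoidAlgebra.basisLift_single, c.rem_mul]

variable (R) in
/-- The contraction of the periodic complex of `g` on the group ring. -/
noncomputable def contraction : PeriodicContraction (leftRegular R K g) n where
  p := c.proj R
  s := c.homotopy R
  pow_eq_one := by rw [← map_pow, c.pow_eq_one, map_one]
  d_s_zero := c.d_homotopy_zero
  s_d_add_d_s := c.homotopy_d_add
  p_d := c.proj_d

lemma commute_proj {h : K} (hrem : ∀ x, c.rem (h * x) = h * c.rem x) :
    Commute (c.proj R) (leftRegular R K h) := by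
  refine MonoidAlgebra.end_ext R fun x => ?_
  simp [proj, MonoidAlgebra.basisLift_single, hrem]

/-- The transversal is stable under h and the exponents do not see h. This is the compatibility
needed to combine the two contractions. -/
lemma commute_homotopy {h : K} (hgh : Commute g h) (hlog : ∀ x, c.log (h * x) = c.log x)
    (hrem : ∀ x, c.rem (h * x) = h * c.rem x) (i : ℕ) :
    Commute (c.homotopy R i) (leftRegular R K h) := by
  refine MonoidAlgebra.end_ext R fun x => ?_
  have (j : ℕ) : g ^ j * (h * c.rem x) = h * (g ^ j * c.rem x) := by
    rw [← mul_assoc, (hgh.pow_left j).eq, mul_assoc]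
  by_cases hi : Even i <;> by_cases hx : c.log x + 1 = n <;>
    simp [homotopy, MonoidAlgebra.basisLift_single, hlog, hrem, this, hi, hx]

end GroupRing

section Product

variable {G H : Type u} [Group G] [Group H]

/-- The exponents of the elements of a finite cyclic group with respect to a generator. -/
lemma exists_log [Finite G] {g : G} (hg : ∀ x, x ∈ Subgroup.zpowers g) :
    ∃ log : G → ℕ, (∀ x, log x < Nat.card G) ∧ (∀ x, g ^ log x = x) ∧
      ∀ j < Nat.card G, log (g ^ j) = j := by
  have hc : orderOf g = Nat.card G := orderOf_eq_card_of_forall_mem_zpowers hg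
  have (x : G) : ∃ j < Nat.card G, g ^ j = x := by
    obtain ⟨j, rfl⟩ := mem_powers_iff_mem_zpowers.2 (hg x)
    exact ⟨j % Nat.card G, Nat.mod_lt _ Nat.card_pos, by rw [← hc, pow_mod_orderOf]⟩
  choose log hlt hpow using this
  refine ⟨log, hlt, hpow, fun j hj => ?_⟩
  exact pow_injOn_Iio_orderOf (by simpa [hc] using hlt _) (by simpa [hc] using hj) (hpow _)

variable [Finite G]

/-- The decomposition of `G × H` along its finite cyclic first factor. -/
noncomputable def fst (H : Type u) [Group H] {g : G} (hg : ∀ x, x ∈ Subgroup.zpowers g) :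
    CyclicDecomposition ((g, 1) : G × H) (Nat.card G) where
  log x := (exists_log hg).choose x.1
  rem x := (1, x.2)
  pow_eq_one := by ext <;> simp
  log_lt x := (exists_log hg).choose_spec.1 _
  pow_log_mul_rem x := by ext <;> simp [(exists_log hg).choose_spec.2.1]
  log_pow_mul_rem x j hj := by simpa using (exists_log hg).choose_spec.2.2 j hj
  rem_pow_mul_rem x j hj := by simp

/-- The decomposition of `H × G` along its finite cyclic second factor. -/
noncomputable def snd (H : Type u) [Group H] {g : G} (hg : ∀ x, x ∈ Subgroup.zpowers g) :
    CyclicDecomposition ((1, g) : H × G) (Nat.card G) where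
  log x := (exists_log hg).choose x.2
  rem x := (x.1, 1)
  pow_eq_one := by ext <;> simp
  log_lt x := (exists_log hg).choose_spec.1 _
  pow_log_mul_rem x := by ext <;> simp [(exists_log hg).choose_spec.2.1]
  log_pow_mul_rem x j hj := by simpa using (exists_log hg).choose_spec.2.2 j hj
  rem_pow_mul_rem x j hj := by simp

end Product

end CyclicDecomposition

/-! ### The free resolution for a product of two cyclic groups. -/

namespace BiperiodicComplex

section Resolution

variable (R : Type u) {K : Type u} [CommRing R] [CommGroup K] (g h : K) {r s : ℕ}

/-- The differential of the total complex of the periodic complexes of `g` and `h` on the group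
ring, as a morphism of representations. -/
noncomputable def repD (r s n : ℕ) :
    Rep.free R K (Bidegree.{u} (n + 1)) ⟶ Rep.free R K (Bidegree.{u} n) :=
  Rep.ofHom ⟨d (leftRegular R K g) (leftRegular R K h) r s n, fun k => by
    have hc (x : K) : Commute (leftRegular R K k) (leftRegular R K x) := by
      rw [Commute, SemiconjBy, ← map_mul, mul_comm, map_mul]
    have hg (i : ℕ) (m) : periodicD (leftRegular R K g) r i (leftRegular R K k m) =
        leftRegular R K k (periodicD (leftRegular R K g) r i m) :=
      congr($(((hc g).periodicD_right r i).symm.eq) m)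
    have hh (i : ℕ) (m) : periodicD (leftRegular R K h) s i (leftRegular R K k m) =
        leftRegular R K k (periodicD (leftRegular R K h) s i m) :=
      congr($(((hc h).periodicD_right s i).symm.eq) m)
    refine Finsupp.lhom_ext fun p m => ?_
    obtain ⟨⟨⟨_ | i, _ | j⟩, hp⟩⟩ := p <;>
      simp [-ofMulAction_single, d_single, dFst, dSnd, hg, hh]⟩

lemma repD_apply (n : ℕ) (x) : (repD R g h r s n).hom x =
    d (leftRegular R K g) (leftRegular R K h) r s n x := rfl

variable {g h}

/-- The total complex of the periodic complexes of `g` and `h` on the group ring. -/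
noncomputable abbrev repComplex (hg : g ^ r = 1) (hh : h ^ s = 1) : ChainComplex (Rep R K) ℕ :=
  ChainComplex.of (fun n => Rep.free R K (Bidegree.{u} n)) (repD R g h r s) fun n => by
    ext : 2
    refine d_comp_d ?_ ?_ ?_ n
    · rw [Commute, SemiconjBy, ← map_mul, mul_comm, map_mul]
    · rw [← map_pow, hg, map_one]
    · rw [← map_pow, hh, map_one]

lemma repComplex_d (hg : g ^ r = 1) (hh : h ^ s = 1) (n : ℕ) :
    (repComplex R hg hh).d (n + 1) n = repD R g h r s n := by simp

/-- The augmentation of the total complex. -/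
noncomputable def augmentation : Rep.free R K (Bidegree.{u} 0) ⟶ Rep.trivial R K R :=
  Rep.freeLift R K (A := Rep.trivial R K R) fun _ => 1

lemma augmentation_single (p : Bidegree.{u} 0) (k : K) (a : R) :
    (augmentation R).hom (Finsupp.single p (.single k a)) = a := by
  simp [augmentation]

lemma d_comp_augmentation (hg : g ^ r = 1) (hh : h ^ s = 1) :
    (repComplex R hg hh).d 1 0 ≫ augmentation R = 0 := by
  rw [repComplex_d]
  refine Rep.free_ext _ _ _ _ _ fun p => ?_
  rw [Rep.hom_comp, IntertwiningMap.comp_apply, repD_apply, d_single]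
  obtain ⟨⟨⟨_ | _ | i, _ | _ | j⟩, hp⟩⟩ := p <;> dsimp at hp <;> try omega
  all_goals
    simp [dFst, dSnd, periodicD]
    exact sub_eq_zero.2 ((augmentation_single R _ _ _).trans (augmentation_single R _ _ _).symm)

variable (cg : CyclicDecomposition g r) (ch : CyclicDecomposition h s)

/-- The augmentation of the total complex, as a morphism of complexes. -/
noncomputable def repπ (hg : g ^ r = 1) (hh : h ^ s = 1) :
    repComplex R hg hh ⟶ (ChainComplex.single₀ (Rep R K)).obj (Rep.trivial R K R) :=
  ((repComplex R hg hh).toSingle₀Equiv _).symm ⟨augmentation R, d_comp_augmentation R hg hh⟩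

lemma exact_augmentation (hrem : ∀ x, ch.rem (cg.rem x) = 1)
    {x : Bidegree.{u} 0 →₀ MonoidAlgebra R K} (hx : (augmentation R).hom x = 0) :
    ∃ y, d (leftRegular R K g) (leftRegular R K h) r s 0 y = x := by
  refine ⟨homotopy (cg.contraction R) (ch.contraction R) 0 x, ?_⟩
  rw [d_homotopy_zero, sub_eq_self]
  -- By `hrem` the two projections together send every group element to 1, so the defect of the
  -- homotopy in degree zero factors through the augmentation.
  have key : Finsupp.mapRange.linearMap ((ch.contraction R).p * (cg.contraction R).p) =
      (Finsupp.lsingle (Bidegree.mk.{u} 0 0 rfl) ∘ₗ MonoidAlgebra.lsingle (1 : K)) ∘ₗ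
        (augmentation (K := K) R).hom.toLinearMap := by
    refine Finsupp.lhom_ext' fun p => MonoidAlgebra.lhom_ext' fun k => LinearMap.ext_ring ?_
    obtain ⟨⟨⟨i, j⟩, hp⟩⟩ := p
    dsimp at hp
    obtain ⟨rfl, rfl⟩ : i = 0 ∧ j = 0 := by omega
    simp [CyclicDecomposition.contraction, CyclicDecomposition.proj,
      MonoidAlgebra.basisLift_single, hrem]
    congr 2
    exact (augmentation_single R _ k 1).symm
  rw [key]
  simp [hx]

lemma quasiIso_repπ (hlog : ∀ x, cg.log (h * x) = cg.log x)
    (hmul : ∀ x, cg.rem (h * x) = h * cg.rem x) (hrem : ∀ x, ch.rem (cg.rem x) = 1) :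
    QuasiIso (repπ R cg.pow_eq_one ch.pow_eq_one) where
  quasiIsoAt m := by
    cases m with
    | zero =>
      rw [ChainComplex.quasiIsoAt₀_iff, ShortComplex.quasiIso_iff_of_zeros' _ rfl rfl rfl]
      constructor
      · apply (forget₂ _ (ModuleCat R)).reflects_exact_of_faithful
        rw [ShortComplex.moduleCat_exact_iff]
        intro x hx
        obtain ⟨y, hy⟩ := exact_augmentation R cg ch hrem (x := x)
          (by simpa [repπ, ChainComplex.toSingle₀Equiv] using! hx)
        exact ⟨y, by simpa [repD_apply] using! hy⟩
      · rw [Rep.epi_iff_surjective]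
        intro x
        refine ⟨Finsupp.single (Bidegree.mk 0 0 rfl) (.single 1 x), ?_⟩
        simpa [repπ, ChainComplex.toSingle₀Equiv] using! augmentation_single R _ (1 : K) x
    | succ m =>
      rw [quasiIsoAt_iff_exactAt' (hL := ChainComplex.exactAt_succ_single_obj ..),
        HomologicalComplex.exactAt_iff' _ (m + 2) (m + 1) m (by simp) (by simp)]
      apply (forget₂ _ (ModuleCat R)).reflects_exact_of_faithful
      rw [ShortComplex.moduleCat_exact_iff]
      intro x hx
      obtain ⟨y, hy⟩ := exists_d_eq (hγ := cg.contraction R) (ch.contraction R)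
        (fun i => cg.commute_homotopy (mul_comm g h) hlog hmul i) (cg.commute_proj hmul) (x := x)
        (n := m) (by simpa [repD_apply] using! hx)
      refine ⟨y, ?_⟩
      change ((repComplex R cg.pow_eq_one ch.pow_eq_one).d (m + 1 + 1) (m + 1)).hom y = x
      rw [repComplex_d]
      exact hy

/-- The total complex of the periodic complexes of `g` and `h` on the group ring of `K` is a
projective resolution, if `K` is the product of the subgroups generated by `g` and `h`. -/
noncomputable def resolution (hlog : ∀ x, cg.log (h * x) = cg.log x)
    (hmul : ∀ x, cg.rem (h * x) = h * cg.rem x) (hrem : ∀ x, ch.rem (cg.rem x) = 1) :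
    ProjectiveResolution (Rep.trivial R K R) where
  complex := repComplex R cg.pow_eq_one ch.pow_eq_one
  projective _ := Rep.free_projective.{u, u}
  π := repπ R cg.pow_eq_one ch.pow_eq_one
  quasiIso := quasiIso_repπ R cg ch hlog hmul hrem

end Resolution

end BiperiodicComplex

/-! ### Cochains with trivial coefficients. -/

namespace BiperiodicComplex

section Cochains

/-- The differential of the periodic complex acts on a trivial representation by multiplication
with this number. -/
def trivialD (n i : ℕ) : ℕ := if Even i then 0 else n

variable {R V : Type u} [CommRing R] [AddCommGroup V] [Module R V]

/-- The horizontal part of the differential on cochains with trivial coefficients. -/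
def cochainFst (r : ℕ) {n : ℕ} (f : Bidegree.{u} n → V) : Bidegree.{u} (n + 1) → V
  | ⟨⟨(0, _), _⟩⟩ => 0
  | ⟨⟨(i + 1, j), h⟩⟩ => trivialD r i • f (.mk i j (by dsimp at h; omega))

variable (R) in
/-- The vertical part of the differential on cochains with trivial coefficients. -/
def cochainSnd (s : ℕ) {n : ℕ} (f : Bidegree.{u} n → V) : Bidegree.{u} (n + 1) → V
  | ⟨⟨(_, 0), _⟩⟩ => 0
  | ⟨⟨(i, j + 1), h⟩⟩ => (-1 : R) ^ i • trivialD s j • f (.mk i j (by dsimp at h; omega))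

variable (R V) in
/-- The complex of cochains with trivial coefficients of the product of two periodic complexes. -/
def cochainD (r s n : ℕ) : (Bidegree.{u} n → V) →ₗ[R] (Bidegree.{u} (n + 1) → V) where
  toFun f p := cochainFst r f p + cochainSnd R s f p
  map_add' f f' := by
    ext ⟨⟨⟨_ | i, _ | j⟩, hp⟩⟩ <;> simp [cochainFst, cochainSnd]; abel
  map_smul' a f := by
    ext ⟨⟨⟨_ | i, _ | j⟩, hp⟩⟩ <;> simp [cochainFst, cochainSnd, smul_comm a]

variable {K : Type u} [CommGroup K] {g h : K} {r s : ℕ}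

/-- A morphism to a trivial representation takes one value on all group elements in a given
coordinate, so g - 1 gives 0 and the norm counts its terms. -/
lemma hom_single_periodicD {n : ℕ} (f : Rep.free R K (Bidegree.{u} n) ⟶ Rep.trivial R K V)
    (p : Bidegree.{u} n) (k : K) (r i : ℕ) :
    f.hom (Finsupp.single p (periodicD (leftRegular R K k) r i (.single 1 1))) =
      trivialD r i • f.hom (Finsupp.single p (.single 1 1)) := by
  have key (x : K) : f.hom (Finsupp.single p (.single x 1)) =
      f.hom (Finsupp.single p (.single 1 1)) := by
    simpa using Rep.hom_comm_apply f x (Finsupp.single p (.single 1 1))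
  by_cases hi : Even i
  · simp [periodicD, trivialD, hi, Finsupp.single_sub, key]
  · have : ∑ j ∈ Finset.range r, f.hom (Finsupp.single p (.single (k ^ j) 1)) =
        r • f.hom (Finsupp.single p (.single 1 1)) := by
      simp [key]
    rw [periodicD, trivialD, if_neg hi, if_neg hi, ← this, ← map_sum, ← Finsupp.single_finsetSum]
    simp [LinearMap.sum_apply, CyclicDecomposition.leftRegular_pow_single]

lemma cochainD_freeLiftLEquiv {n : ℕ}
    (f : Rep.free R K (Bidegree.{u} n) ⟶ Rep.trivial R K V) :
    Rep.freeLiftLEquiv R K _ _ (repD R g h r s n ≫ f) =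
      cochainD R V r s n (Rep.freeLiftLEquiv R K _ (Rep.trivial R K V) f) := by
  ext p
  change f.hom (d _ _ r s n (Finsupp.single p (.single 1 1))) = _
  rw [d_single, map_add]
  refine congrArg₂ (· + ·) ?_ ?_
  · obtain ⟨⟨⟨_ | i, j⟩, hp⟩⟩ := p
    · simp [dFst, cochainFst]
    · exact hom_single_periodicD f _ g r i
  · obtain ⟨⟨⟨i, _ | j⟩, hp⟩⟩ := p
    · simp [dSnd, cochainSnd]
    · refine (map_smul f.hom _ _).trans (congrArg _ ?_)
      exact hom_single_periodicD f _ h s j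

lemma cochainD_comp (r s n : ℕ) : cochainD R V r s (n + 1) ∘ₗ cochainD R V r s n = 0 := by
  have h (m i : ℕ) : trivialD m (i + 1) * trivialD m i = 0 := by
    by_cases hi : Even i <;> simp [trivialD, hi, Nat.even_add_one]
  have hc (a i : ℕ) (v : V) : a • (-1 : R) ^ i • v = (-1 : R) ^ i • a • v := smul_comm _ _ _
  ext f ⟨⟨⟨i, j⟩, hp⟩⟩
  rcases i with _ | _ | i <;> rcases j with _ | _ | j <;>
    simp [cochainD, cochainFst, cochainSnd, hc, ← mul_nsmul', h, pow_succ, mul_comm]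

variable (R V r s) in
/-- The complex of cochains with trivial coefficients around a positive degree. -/
noncomputable abbrev cochainShortComplex (n : ℕ) : ShortComplex (ModuleCat.{u} R) :=
  ShortComplex.mk (ModuleCat.ofHom (cochainD R V r s n)) (ModuleCat.ofHom (cochainD R V r s (n + 1)))
    (by rw [← ModuleCat.ofHom_comp, cochainD_comp]; rfl)

variable (R V) in
/-- The cohomology of the product of two finite cyclic groups with trivial coefficients is the
cohomology of the product of two periodic complexes. -/
noncomputable def groupCohomologyIso (cg : CyclicDecomposition g r) (ch : CyclicDecomposition h s)
    (hlog : ∀ x, cg.log (h * x) = cg.log x) (hmul : ∀ x, cg.rem (h * x) = h * cg.rem x)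
    (hrem : ∀ x, ch.rem (cg.rem x) = 1) (n : ℕ) :
    groupCohomology (Rep.trivial R K V) (n + 1) ≅ (cochainShortComplex R V r s n).homology :=
  _root_.groupCohomologyIso _ _ (resolution R cg ch hlog hmul hrem) ≪≫
    (HomologicalComplex.homologyIsoSc' _ n (n + 1) (n + 2) (by simp) (by simp)) ≪≫
    ShortComplex.homologyMapIso (ShortComplex.isoMk
      (Rep.freeLiftLEquiv R K _ (Rep.trivial R K V)).toModuleIso
      (Rep.freeLiftLEquiv R K _ (Rep.trivial R K V)).toModuleIso
      (Rep.freeLiftLEquiv R K _ (Rep.trivial R K V)).toModuleIso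
      (by
        ext f : 2
        refine (cochainD_freeLiftLEquiv (g := g) (h := h) f).symm.trans ?_
        rw [← repComplex_d R cg.pow_eq_one ch.pow_eq_one]
        rfl)
      (by
        ext f : 2
        refine (cochainD_freeLiftLEquiv (g := g) (h := h) f).symm.trans ?_
        rw [← repComplex_d R cg.pow_eq_one ch.pow_eq_one]
        rfl))

end Cochains

end BiperiodicComplex

/-! ### Homology as a quotient of cycles, and the cyclic case. -/

/-- The homology of a short complex of modules is the image of any additive map on the cycles
whose kernel consists of the boundaries. -/
lemma CategoryTheory.ShortComplex.nonempty_homology_addEquiv {R : Type u} [Ring R]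
    (S : ShortComplex (ModuleCat.{u} R)) {B : Type*} [AddCommGroup B]
    (ψ : LinearMap.ker S.g.hom →+ B) (hψ : Function.Surjective ψ)
    (h : ∀ x, ψ x = 0 ↔ ∃ y, S.f y = x.1) : Nonempty (S.homology ≃+ B) := by
  have hker (x : LinearMap.ker S.g.hom) :
      x ∈ LinearMap.range S.moduleCatToCycles ↔ ψ x = 0 := by
    rw [h]
    exact exists_congr fun y => Subtype.ext_iff
  let e : S.moduleCatLeftHomologyData.H ≃+ B :=
    (QuotientAddGroup.quotientAddEquivOfEq (M := (LinearMap.range S.moduleCatToCycles).toAddSubgroup)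
      (N := ψ.ker) (AddSubgroup.ext hker)).trans
      (QuotientAddGroup.quotientKerEquivOfSurjective ψ hψ)
  exact ⟨S.moduleCatHomologyIso.toLinearEquiv.toAddEquiv.trans e⟩

/-- The element of order dividing `n` in the unit group, as a root of unity. -/
def unitsTorsion {k : Type u} [Field k] {n : ℕ} (a : Additive kˣ) (h : n • a = 0) :
    rootsOfUnity n k := ⟨a.toMul, h⟩

lemma nonempty_unitsH3_cyclic (k : Type u) [Field k] (G : Type u) [CommGroup G] [Finite G]
    {g : G} (hg : ∀ x, x ∈ Subgroup.zpowers g) :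
    Nonempty (unitsH3 G k ≃+ Additive (rootsOfUnity (Nat.card G) k)) := by
  have := Fintype.ofFinite G
  let A := Rep.trivial (ULift.{u} ℤ) G (Additive kˣ)
  have hnorm (a : Additive kˣ) : A.norm.hom.toLinearMap a = Nat.card G • a := by
    simp [A, Rep.norm, Representation.norm, Nat.card_eq_fintype_card]
  have hsub (a : Additive kˣ) : (Rep.applyAsHom A g - 𝟙 A).hom.toLinearMap a = 0 := by
    simp [A, Rep.sub_hom, Rep.applyAsHom]
  obtain ⟨e⟩ := (Rep.FiniteCyclicGroup.subCompNormHom A g).nonempty_homology_addEquiv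
    (B := Additive (rootsOfUnity (Nat.card G) k))
    (AddMonoidHom.mk' (fun x => .ofMul (unitsTorsion x.1 ((hnorm x.1).symm.trans x.2)))
      fun _ _ => rfl)
    (fun ζ => ⟨⟨.ofMul ζ.toMul.1, (hnorm _).trans ζ.toMul.2⟩, rfl⟩)
    (fun x => ⟨fun h => ⟨0, (hsub 0).trans (congrArg (fun ζ => Additive.ofMul ζ.toMul.1) h).symm⟩,
      fun ⟨y, hy⟩ => congrArg Additive.ofMul <| Subtype.ext <|
        congrArg Additive.toMul (hy.symm.trans (hsub y))⟩)
  exact ⟨(Rep.FiniteCyclicGroup.groupCohomologyIsoOdd A g hg 3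
    (by decide)).toLinearEquiv.toAddEquiv.trans e⟩

/-! ### Degree three for the product. -/

namespace BiperiodicComplex

variable {R V : Type u} [CommRing R] [AddCommGroup V] [Module R V]

lemma cochainD_three_eq_zero_iff (r s : ℕ) (x : Bidegree.{u} 3 → V) :
    cochainD R V r s 3 x = 0 ↔ r • x (.mk 3 0 rfl) = 0 ∧ s • x (.mk 0 3 rfl) = 0 ∧
      r • x (.mk 1 2 rfl) + s • x (.mk 2 1 rfl) = 0 := by
  constructor
  · intro h
    have h₁ := congrFun h (.mk 4 0 rfl)
    have h₂ := congrFun h (.mk 0 4 rfl)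
    have h₃ := congrFun h (.mk 2 2 rfl)
    simp [cochainD, cochainFst, cochainSnd, trivialD, Nat.even_add_one] at h₁ h₂ h₃
    exact ⟨h₁, h₂, h₃⟩
  · rintro ⟨h₁, h₂, h₃⟩
    ext ⟨⟨⟨i, j⟩, hp⟩⟩
    dsimp at hp
    obtain ⟨rfl, rfl⟩ | ⟨rfl, rfl⟩ | ⟨rfl, rfl⟩ | ⟨rfl, rfl⟩ | ⟨rfl, rfl⟩ :
      (i = 0 ∧ j = 4) ∨ (i = 1 ∧ j = 3) ∨ (i = 2 ∧ j = 2) ∨ (i = 3 ∧ j = 1) ∨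
        (i = 4 ∧ j = 0) := by omega
    all_goals simp [cochainD, cochainFst, cochainSnd, trivialD, Nat.even_add_one, h₁, h₂, h₃]

lemma exists_cochainD_two_eq_iff (r s : ℕ) (x : Bidegree.{u} 3 → V) :
    (∃ y, cochainD R V r s 2 y = x) ↔ x (.mk 3 0 rfl) = 0 ∧ x (.mk 0 3 rfl) = 0 ∧
      ∃ t, x (.mk 2 1 rfl) = r • t ∧ x (.mk 1 2 rfl) = - (s • t) := by
  constructor
  · rintro ⟨y, rfl⟩
    refine ⟨?_, ?_, y (.mk 1 1 rfl), ?_, ?_⟩ <;>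
      simp [cochainD, cochainFst, cochainSnd, trivialD, Nat.even_add_one]
  · rintro ⟨h₁, h₂, t, h₃, h₄⟩
    -- Only the value at (1,1) matters: the differentials out of (2,0) and (0,2) vanish, their
    -- indices being even.
    refine ⟨fun _ => t, ?_⟩
    ext ⟨⟨⟨i, j⟩, hp⟩⟩
    dsimp at hp
    obtain ⟨rfl, rfl⟩ | ⟨rfl, rfl⟩ | ⟨rfl, rfl⟩ | ⟨rfl, rfl⟩ :
      (i = 0 ∧ j = 3) ∨ (i = 1 ∧ j = 2) ∨ (i = 2 ∧ j = 1) ∨ (i = 3 ∧ j = 0) := by omega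
    · exact (by simp [cochainD, cochainFst, cochainSnd, trivialD] :
        _ = (0 : V)).trans h₂.symm
    · exact (by simp [cochainD, cochainFst, cochainSnd, trivialD, Nat.even_add_one] :
        _ = -(s • t)).trans h₄.symm
    · exact (by simp [cochainD, cochainFst, cochainSnd, trivialD, Nat.even_add_one] :
        _ = r • t).trans h₃.symm
    · exact (by simp [cochainD, cochainFst, cochainSnd, trivialD] :
        _ = (0 : V)).trans h₁.symm

/-- The Bézout substitution (b, c) ↦ (X, Y) has determinant -1, so it diagonalises the cycles and
boundaries at the two middle positions. -/
lemma nonempty_cochain_homology_addEquiv (k : Type u) [Field k] [Module R (Additive kˣ)]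
    {r : ℕ} (s : ℕ) (hr : 0 < r) :
    Nonempty ((cochainShortComplex R (Additive kˣ) r s 2).homology ≃+
      Additive ((kˣ ⧸ unitsPow k (Nat.gcd r s)) ×
        rootsOfUnity r k × rootsOfUnity s k × rootsOfUnity (Nat.gcd r s) k)) := by
  have hd0 : 0 < Nat.gcd r s := Nat.gcd_pos_of_pos_left s hr
  have hbez := Nat.gcd_eq_gcd_ab r s
  obtain ⟨r', hr'⟩ := Nat.gcd_dvd_left r s
  obtain ⟨s', hs'⟩ := Nat.gcd_dvd_right r s
  generalize Nat.gcdA r s = u at hbez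
  generalize Nat.gcdB r s = v at hbez
  generalize Nat.gcd r s = d at *
  subst hr' hs'
  have huv : r' * u + s' * v = 1 := by
    refine mul_left_cancel₀ (Nat.cast_ne_zero.2 hd0.ne' : (d : ℤ) ≠ 0) ?_
    push_cast at hbez
    linear_combination -hbez
  have key₁ (b c : Additive kˣ) (h : (d * r') • c + (d * s') • b = 0) :
      d • (s' • b + r' • c) = 0 := by
    rw [← h]; module
  -- The inverse substitution is b = v X + r' Y, c = u X - s' Y; this and `key₃` check it, and
  -- `key₄` reads off the boundaries X = 0, Y = d t.
  have key₂ (X Y : Additive kˣ) :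
      s' • (v • X + r' • Y) + r' • (u • X - s' • Y) = X := by
    linear_combination (norm := module) huv • X
  have key₃ (X Y : Additive kˣ) :
      u • (v • X + r' • Y) - v • (u • X - s' • Y) = Y := by
    linear_combination (norm := module) huv • Y
  have key₄ (b c t : Additive kˣ) (hX : s' • b + r' • c = 0) (hY : u • b - v • c = d • t) :
      b = (d * r') • t ∧ c = -((d * s') • t) := by
    constructor
    · linear_combination (norm := module) v • hX + r' • hY - huv • b
    · linear_combination (norm := module) u • hX - s' • hY - huv • c
  let f (x : LinearMap.ker (cochainD R (Additive kˣ) (d * r') (d * s') 3)) :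
      Additive ((kˣ ⧸ unitsPow k d) ×
        rootsOfUnity (d * r') k × rootsOfUnity (d * s') k × rootsOfUnity d k) :=
    have h := (cochainD_three_eq_zero_iff _ _ x.1).1 x.2
    .ofMul (QuotientGroup.mk (u • x.1 (.mk 2 1 rfl) - v • x.1 (.mk 1 2 rfl)).toMul,
      unitsTorsion _ h.1, unitsTorsion _ h.2.1, unitsTorsion _ (key₁ _ _ h.2.2))
  refine ShortComplex.nonempty_homology_addEquiv
    (cochainShortComplex R (Additive kˣ) (d * r') (d * s') 2)
    (AddMonoidHom.mk' f fun x y => ?_) ?_ ?_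
  · have h₁ (b c b' c' : Additive kˣ) : u • (b + b') - v • (c + c') =
          (u • b - v • c) + (u • b' - v • c') := by module
    have h₂ (b c b' c' : Additive kˣ) : s' • (b + b') + r' • (c + c') =
          (s' • b + r' • c) + (s' • b' + r' • c') := by module
    refine congrArg Additive.ofMul (Prod.ext ?_ (Prod.ext rfl (Prod.ext rfl ?_)))
    · exact congrArg (fun a : Additive kˣ => (a.toMul : kˣ ⧸ unitsPow k d)) (h₁ ..)
    · exact Subtype.ext (congrArg Additive.toMul (h₂ ..))
  · rintro ⟨Y, a, e, X⟩
    induction Y using QuotientGroup.induction_on with | H Y => ?_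
    let X' : Additive kˣ := .ofMul X.1
    let Y' : Additive kˣ := .ofMul Y
    have hX : d • X' = 0 := X.2
    let x : Bidegree.{u} 3 → Additive kˣ := fun p =>
      if p.down.1.1 = 3 then .ofMul a.1 else if p.down.1.1 = 2 then v • X' + r' • Y'
      else if p.down.1.1 = 1 then u • X' - s' • Y' else .ofMul e.1
    refine ⟨⟨x, (cochainD_three_eq_zero_iff _ _ x).2 ⟨a.2, e.2, ?_⟩⟩, ?_⟩
    · change (d * r') • (u • X' - s' • Y') + (d * s') • (v • X' + r' • Y') = 0
      linear_combination (norm := module) huv • (d • X') + hX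
    · refine congrArg Additive.ofMul (Prod.ext ?_ (Prod.ext rfl (Prod.ext rfl ?_)))
      · exact congrArg (fun a : Additive kˣ => (a.toMul : kˣ ⧸ unitsPow k d)) (key₃ X' Y')
      · exact Subtype.ext (congrArg Additive.toMul (key₂ X' Y'))
  · intro x
    refine Iff.trans ?_ (exists_cochainD_two_eq_iff _ _ x.1).symm
    constructor
    · intro h
      have h₁ := congrArg (fun z => Additive.ofMul z.toMul.2.1.1) h
      have h₂ := congrArg (fun z => Additive.ofMul z.toMul.2.2.1.1) h
      have h₃ := congrArg (fun z => Additive.ofMul z.toMul.2.2.2.1) h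
      obtain ⟨t, ht⟩ := (QuotientGroup.eq_one_iff _).1 (congrArg (fun z => z.toMul.1) h)
      exact ⟨h₁, h₂, .ofMul t, key₄ _ _ _ h₃ ht.symm⟩
    · rintro ⟨h₁, h₂, t, hb, hc⟩
      refine congrArg Additive.ofMul (Prod.ext ?_ (Prod.ext ?_ (Prod.ext ?_ ?_)))
      · refine (QuotientGroup.eq_one_iff _).2 ⟨t.toMul, ?_⟩
        refine congrArg Additive.toMul (?_ : d • t = u • x.1 _ - v • x.1 _)
        rw [hb, hc]
        linear_combination (norm := module) -(d * huv) • t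
      · exact Subtype.ext (congrArg Additive.toMul h₁)
      · exact Subtype.ext (congrArg Additive.toMul h₂)
      · refine Subtype.ext (congrArg Additive.toMul (?_ : s' • x.1 _ + r' • x.1 _ = 0))
        rw [hb, hc]
        module

end BiperiodicComplex

lemma nonempty_unitsH3_prod (k : Type u) [Field k] (G H : Type u) [CommGroup G] [CommGroup H]
    [Finite G] [Finite H] {g : G} (hg : ∀ x, x ∈ Subgroup.zpowers g) {h : H}
    (hh : ∀ x, x ∈ Subgroup.zpowers h) :
    Nonempty (unitsH3 (G × H) k ≃+
      Additive ((kˣ ⧸ unitsPow k (Nat.gcd (Nat.card G) (Nat.card H))) ×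
        rootsOfUnity (Nat.card G) k × rootsOfUnity (Nat.card H) k ×
          rootsOfUnity (Nat.gcd (Nat.card G) (Nat.card H)) k)) := by
  obtain ⟨e⟩ := BiperiodicComplex.nonempty_cochain_homology_addEquiv (R := ULift.{u} ℤ) k
    (Nat.card H) (Nat.card_pos (α := G))
  -- The short complex indexed by 2 has its middle term in degree 3.
  let i := BiperiodicComplex.groupCohomologyIso (ULift.{u} ℤ) (Additive kˣ)
    (CyclicDecomposition.fst H hg) (CyclicDecomposition.snd G hh)
    (fun x => by simp [CyclicDecomposition.fst]) (fun x => by simp [CyclicDecomposition.fst])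
    (fun x => by simp [CyclicDecomposition.fst, CyclicDecomposition.snd]) 2
  exact ⟨i.toLinearEquiv.toAddEquiv.trans e⟩

theorem propositionA18 (k : Type u) [Field k] (r s : ℕ) (hr : 0 < r) (hs : 0 < s)
    (G H : Type u) [Group G] [Group H] [IsCyclic G] [IsCyclic H]
    (hG : Nat.card G = r) (hH : Nat.card H = s) :
    Nonempty (unitsH3 G k ≃+ Additive (rootsOfUnity r k)) ∧
    Nonempty (unitsH3 (G × H) k ≃+
      Additive ((kˣ ⧸ unitsPow k (Nat.gcd r s)) ×
        rootsOfUnity r k × rootsOfUnity s k × rootsOfUnity (Nat.gcd r s) k)) := by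
  subst hG hH
  have : Finite G := Nat.finite_of_card_ne_zero hr.ne'
  have : Finite H := Nat.finite_of_card_ne_zero hs.ne'
  let _ : CommGroup G := IsCyclic.commGroup
  let _ : CommGroup H := IsCyclic.commGroup
  obtain ⟨g, hg⟩ := IsCyclic.exists_generator (α := G)
  obtain ⟨h, hh⟩ := IsCyclic.exists_generator (α := H)
  exact ⟨nonempty_unitsH3_cyclic k G hg, nonempty_unitsH3_prod k G H hg hh⟩
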